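/- Let $(M,h)$ be a closed Riemannian spin surface with a fixed orientation and spin structure, let $(N,g)$ be a Riemannian manifold, $B$ a smooth two-form on $N$, $\phi\colon M\to N$ a smooth map and $\psi$ a smooth section of $\Sigma M\otimes\phi^{-1}TN$, where $\Sigma M$ is the spinor bundle. Let $\slashed{D}\psi=\sum_\alpha e_\alpha\cdot\tilde\nabla_{e_\alpha}\psi$ be the twisted Dirac operator, where $\tilde\nabla$ is induced by the spin connection of $(M,h)$ and the Levi-Civita connection of $(N,g)$, $\{e_\alpha\}$ is a local orthonormal frame and $\cdot$ is Clifford multiplication, and put $$E_B(\phi,\psi)=\frac12\int_M\big(|d\phi|^2+\langle\psi,\slashed{D}\psi\rangle\big)\,d\mathrm{vol}_h+\int_M\phi^*B .$$ Then $E_B$ is invariant under conformal changes of the metric on $M$, and so is each of its three terms. Precisely: let $u\colon M\to\mathbb{R}$ be smooth, $\tilde h=e^{2u}h$, equip $(M,\tilde h)$ with the orientation and spin structure corresponding to those of $(M,h)$ (orthonormal frames being rescaled by $e^{-u}$), identify the spinor bundles of $(M,h)$ and $(M,\tilde h)$ isometrically through the corresponding spin frames, and set $\tilde\psi=e^{-u/2}\psi$.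 Then the three integrals $$\int_M|d\phi|^2\,d\mathrm{vol}_h,\qquad \int_M\langle\psi,\slashed{D}\psi\rangle\,d\mathrm{vol}_h,\qquad \int_M\phi^*B=\int_M(\phi^*B)(e_1,e_2)\,d\mathrm{vol}_h$$ (with $(e_1,e_2)$ an oriented orthonormal frame) and hence $E_B(\phi,\psi)$ have the same values for $(h,\phi,\psi)$ as for $(\tilde h,\phi,\tilde\psi)$, all metric-dependent objects on $M$ being formed with $h$, respectively $\tilde h$. -/

import Mathlib

open scoped Manifold ContDiff Bundle Topology
open MeasureTheory

noncomputable section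

namespace MagneticDirac

/-! ### Riemannian metrics, coordinates, volume -/

/-- Smooth Riemannian metrics on a boundaryless `n`-dimensional smooth manifold. -/
abbrev Metric (n : ℕ) (M : Type*) [TopologicalSpace M]
    [ChartedSpace (EuclideanSpace ℝ (Fin n)) M] [IsManifold (𝓡 n) ∞ M] :=
  Bundle.ContMDiffRiemannianMetric (𝓡 n) ∞ (EuclideanSpace ℝ (Fin n))
    (fun x : M => TangentSpace (𝓡 n) x)

/-- A smooth two-form on `N`: a smooth field of skew-symmetric bilinear forms. -/
structure TwoForm (n : ℕ) (N : Type*) [TopologicalSpace N]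
    [ChartedSpace (EuclideanSpace ℝ (Fin n)) N] [IsManifold (𝓡 n) ∞ N] where
  form (y : N) : TangentSpace (𝓡 n) y →L[ℝ] TangentSpace (𝓡 n) y →L[ℝ] ℝ
  skew (y : N) (v w : TangentSpace (𝓡 n) y) : form y v w = - form y w v
  contMDiff : ContMDiff (𝓡 n)
    ((𝓡 n).prod 𝓘(ℝ, EuclideanSpace ℝ (Fin n) →L[ℝ] EuclideanSpace ℝ (Fin n) →L[ℝ] ℝ)) ∞
    (fun y : N => Bundle.TotalSpace.mk'
      (EuclideanSpace ℝ (Fin n) →L[ℝ] EuclideanSpace ℝ (Fin n) →L[ℝ] ℝ)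
      (E := fun y : N => TangentSpace (𝓡 n) y →L[ℝ] TangentSpace (𝓡 n) y →L[ℝ] ℝ) y (form y))

section Coordinates

variable {n : ℕ} {M : Type*} [TopologicalSpace M]
  [ChartedSpace (EuclideanSpace ℝ (Fin n)) M] [IsManifold (𝓡 n) ∞ M]

/-- The coordinate vector `∂_k` at `x` of the chart around `c` (for `x` in its domain). -/
def coordVec (c x : M) (k : Fin n) : TangentSpace (𝓡 n) x :=
  (trivializationAt (EuclideanSpace ℝ (Fin n)) (fun x : M => TangentSpace (𝓡 n) x) c).symmL ℝ x
    (EuclideanSpace.single k 1)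

/-- The coordinate matrix `h_{ij}` of the metric at `x` in the chart around `c`. -/
def gram (h : Metric n M) (c x : M) : Matrix (Fin n) (Fin n) ℝ :=
  fun i j => h.inner x (coordVec c x i) (coordVec c x j)

/-- The coordinate derivative `∂_i h_{jl}` at the centre `c` of the chart around `c`. -/
def gramDeriv (h : Metric n M) (c : M) (i j l : Fin n) : ℝ :=
  fderiv ℝ (fun p => gram h c ((extChartAt (𝓡 n) c).symm p) j l) (extChartAt (𝓡 n) c c)
    (EuclideanSpace.single i 1)

/-- The Christoffel symbol `Γ^k_{ij}` of the Levi-Civita connection, in the chart around `c`,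
at the point `c`. -/
def christoffel (h : Metric n M) (c : M) (k i j : Fin n) : ℝ :=
  (1 / 2) * ∑ l, (gram h c c)⁻¹ k l *
    (gramDeriv h c i j l + gramDeriv h c j i l - gramDeriv h c l i j)

/-- The vector with components `Γ^k_{ij} v^i w^j` at `c`. Recall that `TangentSpace (𝓡 n) c` is
by definition the model space, through the chart around `c`. -/
def christoffelVec (h : Metric n M) (c : M) (v w : EuclideanSpace ℝ (Fin n)) :
    EuclideanSpace ℝ (Fin n) :=
  WithLp.toLp 2 fun k => ∑ i, ∑ j, christoffel h c k i j * v i * w j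

/-- The covariant derivative `∇_w X` at `x` of a vector field `X` along `f : M → N`, for the
pull-back by `f` of the Levi-Civita connection of `(N, g)`:
`(∇_w X)^k = d(X^k)(w) + Γ^k_{ij}(f x) (df w)^i X^j` in the chart around `f x`. -/
def covDerivAlong {m : ℕ} {L : Type*} [TopologicalSpace L]
    [ChartedSpace (EuclideanSpace ℝ (Fin m)) L]
    (g : Metric n M) (f : L → M) (X : (y : L) → TangentSpace (𝓡 n) (f y)) (x : L)
    (w : TangentSpace (𝓡 m) x) : TangentSpace (𝓡 n) (f x) :=
  let dX : EuclideanSpace ℝ (Fin n) :=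
    mfderiv (𝓡 m) 𝓘(ℝ, EuclideanSpace ℝ (Fin n))
      (fun y : L => (trivializationAt (EuclideanSpace ℝ (Fin n))
        (fun z : M => TangentSpace (𝓡 n) z) (f x) ⟨f y, X y⟩).2) x w
  dX + christoffelVec g (f x) (mfderiv (𝓡 m) (𝓡 n) f x w) (X x)

variable [T2Space M] [SigmaCompactSpace M]

variable (n M) in
/-- A smooth partition of unity subordinate to the domains of the charts. -/
def chartPartition : SmoothPartitionOfUnity M (𝓡 n) M Set.univ :=
  (SmoothPartitionOfUnity.exists_isSubordinate_chartAt_source (𝓡 n) M).choose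

/-- The Riemannian volume measure: `∫ f dvol_h = ∑_c ∫ ρ_c f √(det h_{ij}) dx`, the summand with
index `c` being computed in the chart around `c`. -/
def volumeMeasure [MeasurableSpace M] (h : Metric n M) : Measure M :=
  Measure.sum fun c : M =>
    ((volume.restrict (extChartAt (𝓡 n) c).target).withDensity fun p =>
      ENNReal.ofReal (chartPartition n M c ((extChartAt (𝓡 n) c).symm p) *
        √(gram h c ((extChartAt (𝓡 n) c).symm p)).det)).map (extChartAt (𝓡 n) c).symm

end Coordinates

/-! ### Conformal change of the metric -/

section ConformalMetric

variable {n : ℕ} {M : Type*} [TopologicalSpace M]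
  [ChartedSpace (EuclideanSpace ℝ (Fin n)) M] [IsManifold (𝓡 n) ∞ M]

set_option synthInstance.maxHeartbeats 400000 in
/-- The conformally changed metric `e^{2u} h`. -/
def conformalMetric (h : Metric n M) (u : M → ℝ) (hu : ContMDiff (𝓡 n) 𝓘(ℝ) ∞ u) :
    Metric n M where
  inner x := Real.exp (2 * u x) • h.inner x
  symm x v w := by
    simp [h.symm x v w]
  pos x v hv := by
    simpa using mul_pos (Real.exp_pos (2 * u x)) (h.pos x v hv)
  isVonNBounded x := by
    have hb := (h.isVonNBounded x).image
      ((Real.exp (- u x)) • ContinuousLinearMap.id ℝ (TangentSpace (𝓡 n) x))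
    refine hb.subset ?_
    intro v hv
    refine ⟨Real.exp (u x) • v, ?_, ?_⟩
    · have h2 : Real.exp (2 * u x) = Real.exp (u x) * Real.exp (u x) := by
        rw [← Real.exp_add]; ring_nf
      simp only [Set.mem_ofPred_eq, map_smul, smul_apply, smul_eq_mul] at hv ⊢
      rw [h2] at hv
      linarith
    · simp [smul_smul, ← Real.exp_add]
  contMDiff := by
    have hs : ContMDiff (𝓡 n) 𝓘(ℝ) ∞ (fun x => Real.exp (2 * u x)) :=
      Real.contDiff_exp.contMDiff.comp (contMDiff_const.mul hu)
    exact hs.smul_section h.contMDiff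

end ConformalMetric

/-! ### Two-dimensional spinors -/

section Algebra

/-- Clifford multiplication by the standard basis of `ℝ²` on the spinor module `ℂ²`,
with `γ_a γ_b + γ_b γ_a = -2 δ_{ab}`. -/
def gamma : Fin 2 → Matrix (Fin 2) (Fin 2) ℂ :=
  ![!![0, -1; 1, 0], !![0, Complex.I; Complex.I, 0]]

/-- The spinor representation of `Spin(2) = {a + b e₁e₂ : a² + b² = 1}`, which is identified with
the circle `{a + b i}`. The double covering of `SO(2)` is then `z ↦ z²`. -/
def spinRep (z : Circle) : Matrix (Fin 2) (Fin 2) ℂ :=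
  ((z : ℂ).re : ℂ) • (1 : Matrix (Fin 2) (Fin 2) ℂ) + ((z : ℂ).im : ℂ) • (gamma 0 * gamma 1)

variable {V : Type*} [AddCommGroup V] [Module ℝ V]

/-- Multiplication by a complex number on the complexification `V ⊗ ℂ = V × V`, where the pair
`(a, b)` stands for `a + i b`. -/
def cxSmul (z : ℂ) (w : V × V) : V × V :=
  (z.re • w.1 - z.im • w.2, z.im • w.1 + z.re • w.2)

/-- The action of a complex `2 × 2` matrix on `ℂ² ⊗ V = (V ⊗ ℂ)²`. -/
def matAct (A : Matrix (Fin 2) (Fin 2) ℂ) (ψ : Fin 2 → V × V) : Fin 2 → V × V :=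
  fun a => ∑ b, cxSmul (A a b) (ψ b)

/-- The Hermitian product on `ℂ² ⊗ V` induced by the standard one of `ℂ²` and the real inner
product `g` of `V`, conjugate linear in the first variable. -/
def hermitian (g : V → V → ℝ) (χ ξ : Fin 2 → V × V) : ℂ :=
  ∑ a, (((g (χ a).1 (ξ a).1 + g (χ a).2 (ξ a).2 : ℝ) : ℂ) +
    ((g (χ a).1 (ξ a).2 - g (χ a).2 (ξ a).1 : ℝ) : ℂ) * Complex.I)

end Algebra

section Spin

variable {M : Type*} [TopologicalSpace M]
  [ChartedSpace (EuclideanSpace ℝ (Fin 2)) M] [IsManifold (𝓡 2) ∞ M]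

/-- A spin structure (together with the orientation it induces) on a Riemannian surface `(M, h)`:
an open cover `U i` with smooth orthonormal frames `e i`, any two of which differ on the
overlaps by rotations, and smooth lifts `lift i j` of these rotations to `Spin(2)`, which satisfy
the cocycle condition. The `i`-th frame is the image of a local section `s_i` of the principal
`Spin(2)`-bundle, and `s_j = s_i · lift i j`. -/
structure SpinStructure (h : Metric 2 M) where
  ι : Type*
  U : ι → Set M
  isOpen (i : ι) : IsOpen (U i)
  cover (x : M) : ∃ i, x ∈ U i
  e : ι → Fin 2 → (x : M) → TangentSpace (𝓡 2) x
  e_smooth (i : ι) (a : Fin 2) : ContMDiffOn (𝓡 2) (𝓡 2).tangent ∞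
    (fun x => (⟨x, e i a x⟩ : TangentBundle (𝓡 2) M)) (U i)
  orthonormal (i : ι) (x : M) (hx : x ∈ U i) (a b : Fin 2) :
    h.inner x (e i a x) (e i b x) = if a = b then 1 else 0
  lift : ι → ι → M → Circle
  lift_smooth (i j : ι) : ContMDiffOn (𝓡 2) 𝓘(ℝ, ℂ) ∞ (fun x => (lift i j x : ℂ)) (U i ∩ U j)
  lift_zero (i j : ι) (x : M) (hx : x ∈ U i ∩ U j) :
    e j 0 x = ((lift i j x : ℂ) ^ 2).re • e i 0 x + ((lift i j x : ℂ) ^ 2).im • e i 1 x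
  lift_one (i j : ι) (x : M) (hx : x ∈ U i ∩ U j) :
    e j 1 x = -((lift i j x : ℂ) ^ 2).im • e i 0 x + ((lift i j x : ℂ) ^ 2).re • e i 1 x
  cocycle (i j k : ι) (x : M) (hx : x ∈ U i ∩ U j ∩ U k) :
    lift i j x * lift j k x = lift i k x

/-- The spin structure on `(M, e^{2u} h)` that corresponds to a spin structure on `(M, h)`:
the frames are rescaled by `e^{-u}` and the `Spin(2)`-bundle is unchanged. -/
def SpinStructure.conformal {h : Metric 2 M} (s : SpinStructure h) (u : M → ℝ)
    (hu : ContMDiff (𝓡 2) 𝓘(ℝ) ∞ u) : SpinStructure (conformalMetric h u hu) where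
  ι := s.ι
  U := s.U
  isOpen := s.isOpen
  cover := s.cover
  e i a x := Real.exp (- u x) • s.e i a x
  e_smooth i a := by
    have hs : ContMDiff (𝓡 2) 𝓘(ℝ) ∞ (fun x => Real.exp (- u x)) :=
      Real.contDiff_exp.contMDiff.comp hu.neg
    exact hs.contMDiffOn.smul_section (s.e_smooth i a)
  orthonormal i x hx a b := by
    have h1 : Real.exp (2 * u x) * (Real.exp (- u x) * Real.exp (- u x)) = 1 := by
      rw [← Real.exp_add, ← Real.exp_add]; ring_nf; simp
    have h2 := s.orthonormal i x hx a b
    simp only [conformalMetric, map_smul, smul_apply, smul_eq_mul, h2]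
    split_ifs <;> linarith
  lift := s.lift
  lift_smooth := s.lift_smooth
  lift_zero i j x hx := by
    rw [s.lift_zero i j x hx, smul_add, smul_comm, smul_comm (Real.exp (- u x)) _ (s.e i 1 x)]
  lift_one i j x hx := by
    rw [s.lift_one i j x hx, smul_add, smul_comm, smul_comm (Real.exp (- u x)) _ (s.e i 1 x)]
  cocycle := s.cocycle

/-- An index of the cover whose open set contains `x`. -/
def SpinStructure.idx {h : Metric 2 M} (s : SpinStructure h) (x : M) : s.ι :=
  (s.cover x).choose

variable {n : ℕ} {N : Type*} [TopologicalSpace N]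
  [ChartedSpace (EuclideanSpace ℝ (Fin n)) N] [IsManifold (𝓡 n) ∞ N]

variable (n) in
/-- A vector spinor, that is a smooth section of `ΣM ⊗ φ⁻¹TN`. In the spin frame `s_i` it is given
on `U i` by a function with values in `ℂ² ⊗ T_{φ(x)}N`, i.e. by a pair of complexified smooth
vector fields along `φ`; a change of spin frame acts by the spinor representation. -/
structure VectorSpinor {h : Metric 2 M} (s : SpinStructure h) (φ : M → N) where
  comp : s.ι → (x : M) → Fin 2 → TangentSpace (𝓡 n) (φ x) × TangentSpace (𝓡 n) (φ x)
  smooth_re (i : s.ι) (a : Fin 2) : ContMDiffOn (𝓡 2) (𝓡 n).tangent ∞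
    (fun x => (⟨φ x, (comp i x a).1⟩ : TangentBundle (𝓡 n) N)) (s.U i)
  smooth_im (i : s.ι) (a : Fin 2) : ContMDiffOn (𝓡 2) (𝓡 n).tangent ∞
    (fun x => (⟨φ x, (comp i x a).2⟩ : TangentBundle (𝓡 n) N)) (s.U i)
  transition (i j : s.ι) (x : M) (hx : x ∈ s.U i ∩ s.U j) :
    comp i x = matAct (spinRep (s.lift i j x)) (comp j x)

/-- Multiplying a smooth field along `φ` by a smooth function gives a smooth field. -/
theorem smul_along {m : ℕ} {L : Type*} [TopologicalSpace L]
    [ChartedSpace (EuclideanSpace ℝ (Fin m)) L] [IsManifold (𝓡 m) ∞ L] {φ : L → N}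
    {X : (x : L) → TangentSpace (𝓡 n) (φ x)} {f : L → ℝ} {U : Set L}
    (hf : ContMDiff (𝓡 m) 𝓘(ℝ) ∞ f)
    (hX : ContMDiffOn (𝓡 m) (𝓡 n).tangent ∞
      (fun x => (⟨φ x, X x⟩ : TangentBundle (𝓡 n) N)) U) :
    ContMDiffOn (𝓡 m) (𝓡 n).tangent ∞
      (fun x => (⟨φ x, f x • X x⟩ : TangentBundle (𝓡 n) N)) U := by
  intro x hx
  have hX' := Bundle.contMDiffWithinAt_totalSpace.1 (hX x hx)
  refine Bundle.contMDiffWithinAt_totalSpace.2 ⟨hX'.1, ?_⟩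
  have h1 := ((hf x).contMDiffWithinAt (s := U)).smul hX'.2
  have hbase : ∀ᶠ y in 𝓝[U] x, φ y ∈
      (trivializationAt (EuclideanSpace ℝ (Fin n))
        (fun z : N => TangentSpace (𝓡 n) z) (φ x)).baseSet :=
    hX'.1.continuousWithinAt.eventually
      ((trivializationAt (EuclideanSpace ℝ (Fin n))
        (fun z : N => TangentSpace (𝓡 n) z) (φ x)).open_baseSet.mem_nhds
        (FiberBundle.mem_baseSet_trivializationAt' (φ x)))
  refine h1.congr_of_eventuallyEq ?_ ?_
  · filter_upwards [hbase] with y hy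
    exact ((trivializationAt (EuclideanSpace ℝ (Fin n))
        (fun z : N => TangentSpace (𝓡 n) z) (φ x)).linear ℝ hy).map_smul (f y) (X y)
  · exact ((trivializationAt (EuclideanSpace ℝ (Fin n))
        (fun z : N => TangentSpace (𝓡 n) z) (φ x)).linear ℝ
        (FiberBundle.mem_baseSet_trivializationAt' (φ x))).map_smul (f x) (X x)

/-- The vector spinor `e^{-u/2} ψ` on `(M, e^{2u} h)`, where the spinor bundles of `(M, h)` and
`(M, e^{2u} h)` are identified isometrically by means of the spin frames. -/
def VectorSpinor.conformal {h : Metric 2 M} {s : SpinStructure h} {φ : M → N}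
    (ψ : VectorSpinor n s φ) (u : M → ℝ) (hu : ContMDiff (𝓡 2) 𝓘(ℝ) ∞ u) :
    VectorSpinor n (s.conformal u hu) φ where
  comp i x a := Real.exp (- u x / 2) • ψ.comp i x a
  smooth_re i a := by
    have hs : ContMDiff (𝓡 2) 𝓘(ℝ) ∞ (fun x => Real.exp (- u x / 2)) :=
      Real.contDiff_exp.contMDiff.comp (hu.neg.div_const 2)
    exact smul_along hs (ψ.smooth_re i a)
  smooth_im i a := by
    have hs : ContMDiff (𝓡 2) 𝓘(ℝ) ∞ (fun x => Real.exp (- u x / 2)) :=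
      Real.contDiff_exp.contMDiff.comp (hu.neg.div_const 2)
    exact smul_along hs (ψ.smooth_im i a)
  transition i j x hx := by
    funext a
    rw [ψ.transition i j x hx]
    simp only [matAct, cxSmul, Finset.smul_sum]
    refine Finset.sum_congr rfl fun b _ => ?_
    ext <;> simp [SpinStructure.conformal, smul_add, smul_sub, smul_comm (Real.exp (- u x / 2))]

/-! ### The Dirac operator and the energy -/

/-- The connection form `ω(w) = h(∇_w e_1, e_2)` of the `i`-th frame. -/
def connectionForm {h : Metric 2 M} (s : SpinStructure h) (i : s.ι) (x : M)
    (w : TangentSpace (𝓡 2) x) : ℝ :=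
  h.inner x (covDerivAlong h (id : M → M) (s.e i 0) x w) (s.e i 1 x)

/-- The connection `∇̃` of `ΣM ⊗ φ⁻¹TN`, in the `i`-th spin frame: the covariant derivative of the
components along `φ`, plus the spin connection `(1/4) ∑ h(∇_w e_a, e_b) γ_a γ_b`, which is
`(1/2) ω(w) γ_1 γ_2`. -/
def twistedDeriv {h : Metric 2 M} {s : SpinStructure h} {φ : M → N} (g : Metric n N)
    (ψ : VectorSpinor n s φ) (i : s.ι) (x : M) (w : TangentSpace (𝓡 2) x) :
    Fin 2 → TangentSpace (𝓡 n) (φ x) × TangentSpace (𝓡 n) (φ x) :=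
  (fun a => (covDerivAlong g φ (fun y => (ψ.comp i y a).1) x w,
      covDerivAlong g φ (fun y => (ψ.comp i y a).2) x w)) +
    ((1 / 2) * connectionForm s i x w) • matAct (gamma 0 * gamma 1) (ψ.comp i x)

/-- The twisted Dirac operator `D̸ψ = ∑ e_a · ∇̃_{e_a} ψ`, in the `i`-th spin frame. -/
def dirac {h : Metric 2 M} {s : SpinStructure h} {φ : M → N} (g : Metric n N)
    (ψ : VectorSpinor n s φ) (i : s.ι) (x : M) :
    Fin 2 → TangentSpace (𝓡 n) (φ x) × TangentSpace (𝓡 n) (φ x) :=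
  ∑ a, matAct (gamma a) (twistedDeriv g ψ i x (s.e i a x))

/-- `|dφ|² = h^{αβ} g(∂_α φ, ∂_β φ)`. -/
def dirichletDensity (h : Metric 2 M) (g : Metric n N) (φ : M → N) (x : M) : ℝ :=
  ∑ α, ∑ β, (gram h x x)⁻¹ α β *
    g.inner (φ x) (mfderiv (𝓡 2) (𝓡 n) φ x (coordVec x x α))
      (mfderiv (𝓡 2) (𝓡 n) φ x (coordVec x x β))

/-- The Hermitian product `⟨ψ, D̸ψ⟩`; its value does not depend on the spin frame around `x`. -/
def diracDensity {h : Metric 2 M} {s : SpinStructure h} {φ : M → N} (g : Metric n N)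
    (ψ : VectorSpinor n s φ) (x : M) : ℂ :=
  hermitian (fun v w => g.inner (φ x) v w) (ψ.comp (s.idx x) x) (dirac g ψ (s.idx x) x)

/-- The function `(φ^*B)(e_1, e_2)`, for an oriented orthonormal frame `(e_1, e_2)`; the two-form
`φ^*B` is this function times the area form of `h`. -/
def magneticDensity {h : Metric 2 M} (s : SpinStructure h) (B : TwoForm n N) (φ : M → N)
    (x : M) : ℝ :=
  B.form (φ x) (mfderiv (𝓡 2) (𝓡 n) φ x (s.e (s.idx x) 0 x))
    (mfderiv (𝓡 2) (𝓡 n) φ x (s.e (s.idx x) 1 x))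

variable [T2Space M] [CompactSpace M] [MeasurableSpace M]

/-- `∫_M |dφ|² dvol_h`. -/
def dirichletTerm (h : Metric 2 M) (g : Metric n N) (φ : M → N) : ℝ :=
  ∫ x, dirichletDensity h g φ x ∂(volumeMeasure h)

/-- `∫_M ⟨ψ, D̸ψ⟩ dvol_h`. -/
def diracTerm {h : Metric 2 M} {s : SpinStructure h} {φ : M → N} (g : Metric n N)
    (ψ : VectorSpinor n s φ) : ℂ :=
  ∫ x, diracDensity g ψ x ∂(volumeMeasure h)

/-- `∫_M φ^*B`, for the orientation given by the spin structure. -/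
def magneticTerm {h : Metric 2 M} (s : SpinStructure h) (B : TwoForm n N) (φ : M → N) : ℝ :=
  ∫ x, magneticDensity s B φ x ∂(volumeMeasure h)

/-- The energy `E_B(φ, ψ) = (1/2) ∫_M (|dφ|² + ⟨ψ, D̸ψ⟩ + 2 φ^*B)`. It is written as a complex
number because the Hermitian product `⟨ψ, D̸ψ⟩` may have an imaginary part at a point (a divergence,
whose integral vanishes). -/
def energy {h : Metric 2 M} {s : SpinStructure h} {φ : M → N} (g : Metric n N) (B : TwoForm n N)
    (ψ : VectorSpinor n s φ) : ℂ :=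
  (1 / 2) * ∫ x, ((dirichletDensity h g φ x : ℂ) + diracDensity g ψ x +
    2 * (magneticDensity s B φ x : ℂ)) ∂(volumeMeasure h)

end Spin

end MagneticDirac

end

/-! In dimension two the area measure scales by `e^{2u}`, so it suffices that each density formed
with `e^{2u} h` is `e^{-2u}` times the one formed with `h`. The integrals then agree by change of
density, without any integrability.

For `|dφ|²` the factor comes from the inverse metric, and for `(φ^*B)(e_1, e_2)` from the two
rescaled frame vectors. The Dirac term needs `dirac_conformal`: `D̸` of the rescaled spinor is
`e^{-3u/2} D̸ψ`. The conformal formula for the Christoffel symbols shows that the connection form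
`ω(w)` gains `du(e_1) h(w, e_2) - du(e_2) h(w, e_1)`, while differentiating `e^{-u/2}` contributes
`-(1/2) du(w) ψ`. After Clifford multiplication and summation over the frame these contributions
cancel (`clifford_conformal_cancel`). Pairing with `e^{-u/2} ψ` gives the total factor `e^{-2u}`. -/

noncomputable section

namespace MagneticDirac

/-! ### Coordinate frames and smoothness of the Gram matrix. -/

section Coordinates

variable {n : ℕ} {M : Type*} [TopologicalSpace M]
  [ChartedSpace (EuclideanSpace ℝ (Fin n)) M] [IsManifold (𝓡 n) ∞ M]

theorem mem_baseSet_iff (c x : M) :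
    x ∈ (trivializationAt (EuclideanSpace ℝ (Fin n)) (fun x : M => TangentSpace (𝓡 n) x) c).baseSet
      ↔ x ∈ (extChartAt (𝓡 n) c).source := by
  simp

/-- The chart around `c` is the one that identifies the tangent space at `c` with the model space,
so the coordinate change is the identity. -/
theorem trivialization_self (c : M) (v : TangentSpace (𝓡 n) c) :
    (trivializationAt (EuclideanSpace ℝ (Fin n)) (fun x : M => TangentSpace (𝓡 n) x) c
      ⟨c, v⟩).2 = v := by
  rw [TangentBundle.trivializationAt_apply]
  simpa using (tangentBundleCore (𝓡 n) M).coordChange_self (achart _ c) c (by simp) v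

theorem coordVec_self (c : M) (k : Fin n) :
    coordVec c c k = (EuclideanSpace.single k (1 : ℝ) : EuclideanSpace ℝ (Fin n)) := by
  unfold coordVec
  rw [TangentBundle.symmL_trivializationAt_eq_core (by simp)]
  exact (tangentBundleCore (𝓡 n) M).coordChange_self (achart _ c) c (by simp) _

theorem contMDiffOn_coordVec (c : M) (k : Fin n) :
    ContMDiffOn (𝓡 n) (𝓡 n).tangent ∞
      (fun x => (⟨x, coordVec c x k⟩ : TangentBundle (𝓡 n) M)) (extChartAt (𝓡 n) c).source := by
  have h1 := (trivializationAt (EuclideanSpace ℝ (Fin n))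
    (fun x : M => TangentSpace (𝓡 n) x) c).contMDiffOn_symm (IB := 𝓡 n) (n := ∞)
  have h2 : ContMDiffOn (𝓡 n) ((𝓡 n).prod 𝓘(ℝ, EuclideanSpace ℝ (Fin n))) ∞
      (fun x : M => (x, (EuclideanSpace.single k (1 : ℝ) : EuclideanSpace ℝ (Fin n))))
      (extChartAt (𝓡 n) c).source := contMDiffOn_id.prodMk contMDiffOn_const
  refine (h1.comp h2 ?_).congr ?_
  · intro x hx
    rw [Set.mem_preimage, Bundle.Trivialization.mem_target]
    exact (mem_baseSet_iff c x).2 hx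
  · intro x hx
    have hb := (mem_baseSet_iff c x).2 hx
    simp only [Function.comp, coordVec]
    rw [Bundle.Trivialization.symmL_apply _ hb]
    exact Bundle.Trivialization.mk_symm _ hb _

theorem contMDiffOn_gram (h : Metric n M) (c : M) (i j : Fin n) :
    ContMDiffOn (𝓡 n) 𝓘(ℝ) ∞ (fun x => gram h c x i j) (extChartAt (𝓡 n) c).source := by
  have h1 := ContMDiffOn.clm_bundle_apply₂ (F₁ := EuclideanSpace ℝ (Fin n))
    (F₂ := EuclideanSpace ℝ (Fin n)) (F₃ := ℝ) (E₃ := Bundle.Trivial M ℝ)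
    (h.contMDiff.contMDiffOn (s := (extChartAt (𝓡 n) c).source))
    (contMDiffOn_coordVec c i) (contMDiffOn_coordVec c j)
  intro x hx
  have h2 := h1 x hx
  simp only [Bundle.contMDiffWithinAt_totalSpace] at h2
  exact h2.2

end Coordinates

/-! ### Scaling of the volume measure and of integrals. -/

section Volume

/-- Moves a density through a push-forward. Almost everywhere measurability of `f` is the right
generality, since an inverse chart is controlled only on its target. -/
theorem withDensity_comp_map {α β : Type*} [MeasurableSpace α] [MeasurableSpace β]
    {μ : Measure α} {f : α → β} (hf : AEMeasurable f μ) {G : β → ENNReal} (hG : Measurable G) :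
    (μ.withDensity (G ∘ f)).map f = (μ.map f).withDensity G := by
  ext t ht
  have hfG : AEMeasurable f (μ.withDensity (G ∘ f)) :=
    hf.mono_ac (withDensity_absolutelyContinuous _ _)
  rw [Measure.map_apply_of_aemeasurable hfG ht, withDensity_apply _ ht,
    ← lintegral_indicator ht, lintegral_map' (hG.indicator ht).aemeasurable hf,
    withDensity_apply₀, ← lintegral_indicator₀ (hf.nullMeasurableSet_preimage ht)]
  · rfl
  · exact (hf.nullMeasurableSet_preimage ht)

variable {n : ℕ} {M : Type*} [TopologicalSpace M]
  [ChartedSpace (EuclideanSpace ℝ (Fin n)) M] [IsManifold (𝓡 n) ∞ M]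

theorem gram_conformalMetric (h : Metric n M) (u : M → ℝ) (hu : ContMDiff (𝓡 n) 𝓘(ℝ) ∞ u)
    (c x : M) : gram (conformalMetric h u hu) c x = Real.exp (2 * u x) • gram h c x := by
  ext i j
  simp [gram, conformalMetric]

/-- Dimension two enters here: the determinant scales by the square of `e^{2u}`, whose root is
`e^{2u}`. -/
theorem sqrt_det_gram_conformalMetric {M : Type*} [TopologicalSpace M]
    [ChartedSpace (EuclideanSpace ℝ (Fin 2)) M] [IsManifold (𝓡 2) ∞ M]
    (h : Metric 2 M) (u : M → ℝ) (hu : ContMDiff (𝓡 2) 𝓘(ℝ) ∞ u) (c x : M) :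
    √(gram (conformalMetric h u hu) c x).det = Real.exp (2 * u x) * √(gram h c x).det := by
  rw [gram_conformalMetric, Matrix.det_smul, Fintype.card_fin, Real.sqrt_mul (by positivity),
    Real.sqrt_sq (Real.exp_pos _).le]

/-- The partition of unity does not depend on the metric, so the two sums of measures can be
compared chart by chart. -/
theorem volumeMeasure_conformalMetric {M : Type*} [TopologicalSpace M]
    [ChartedSpace (EuclideanSpace ℝ (Fin 2)) M] [IsManifold (𝓡 2) ∞ M]
    [T2Space M] [SigmaCompactSpace M] [MeasurableSpace M] [BorelSpace M]
    (h : Metric 2 M) (u : M → ℝ) (hu : ContMDiff (𝓡 2) 𝓘(ℝ) ∞ u) :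
    volumeMeasure (conformalMetric h u hu) =
      (volumeMeasure h).withDensity (fun x => ENNReal.ofReal (Real.exp (2 * u x))) := by
  have hG : Measurable (fun x => ENNReal.ofReal (Real.exp (2 * u x))) :=
    ((Real.continuous_exp.comp (hu.continuous.const_mul 2)).measurable).ennreal_ofReal
  unfold volumeMeasure
  rw [withDensity_sum]
  congr 1
  funext c
  have ht : MeasurableSet (extChartAt (𝓡 2) c).target :=
    (isOpen_extChartAt_target c).measurableSet
  have hc : ContinuousOn (extChartAt (𝓡 2) c).symm (extChartAt (𝓡 2) c).target :=
    continuousOn_extChartAt_symm c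
  have hf : AEMeasurable (extChartAt (𝓡 2) c).symm
      (volume.restrict (extChartAt (𝓡 2) c).target) := hc.aemeasurable ht
  have hmaps : Set.MapsTo (extChartAt (𝓡 2) c).symm (extChartAt (𝓡 2) c).target
      (extChartAt (𝓡 2) c).source := (extChartAt (𝓡 2) c).symm.mapsTo
  have hgram : ContinuousOn (fun p => gram h c ((extChartAt (𝓡 2) c).symm p))
      (extChartAt (𝓡 2) c).target :=
    continuousOn_pi.2 fun i => continuousOn_pi.2 fun j =>
      (contMDiffOn_gram h c i j).continuousOn.comp hc hmaps
  have hF : AEMeasurable (fun p => ENNReal.ofReal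
      (chartPartition 2 M c ((extChartAt (𝓡 2) c).symm p) *
        √(gram h c ((extChartAt (𝓡 2) c).symm p)).det))
      (volume.restrict (extChartAt (𝓡 2) c).target) := by
    refine (ContinuousOn.aemeasurable ?_ ht).ennreal_ofReal
    refine ((chartPartition 2 M c).contMDiff.continuous.comp_continuousOn hc).mul ?_
    exact Real.continuous_sqrt.comp_continuousOn
      ((continuous_id.matrix_det).comp_continuousOn hgram)
  rw [← withDensity_comp_map (hf.mono_ac (withDensity_absolutelyContinuous _ _)) hG,
    ← withDensity_mul₀ hF (hG.comp_aemeasurable hf)]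
  congr 2
  funext p
  rw [Pi.mul_apply, Function.comp_apply, ← ENNReal.ofReal_mul' (Real.exp_pos _).le, sqrt_det_gram_conformalMetric]
  congr 1
  ring

theorem integral_volumeMeasure_conformalMetric {M : Type*} [TopologicalSpace M]
    [ChartedSpace (EuclideanSpace ℝ (Fin 2)) M] [IsManifold (𝓡 2) ∞ M]
    [T2Space M] [SigmaCompactSpace M] [MeasurableSpace M] [BorelSpace M]
    {E : Type*} [NormedAddCommGroup E] [NormedSpace ℝ E]
    (h : Metric 2 M) (u : M → ℝ) (hu : ContMDiff (𝓡 2) 𝓘(ℝ) ∞ u) {f f' : M → E}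
    (hf : ∀ x, f x = Real.exp (2 * u x) • f' x) :
    ∫ x, f' x ∂(volumeMeasure (conformalMetric h u hu)) = ∫ x, f x ∂(volumeMeasure h) := by
  have hG : Measurable (fun x => ENNReal.ofReal (Real.exp (2 * u x))) :=
    ((Real.continuous_exp.comp (hu.continuous.const_mul 2)).measurable).ennreal_ofReal
  rw [volumeMeasure_conformalMetric, integral_withDensity_eq_integral_toReal_smul hG (by simp)]
  refine integral_congr_ae (.of_forall fun x => ?_)
  simp only [hf, ENNReal.toReal_ofReal (Real.exp_pos _).le]

end Volume

/-! ### Leibniz and chain rules for differentials in a chart. -/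

section Differential

variable {m : ℕ} {L : Type*} [TopologicalSpace L] [ChartedSpace (EuclideanSpace ℝ (Fin m)) L]
  {E : Type*} [NormedAddCommGroup E] [NormedSpace ℝ E]

/-- The differential at `x` of a map into a normed space, in the chart around `x`. -/
def differential (F : L → E) (x : L) : EuclideanSpace ℝ (Fin m) →L[ℝ] E :=
  mfderiv (𝓡 m) 𝓘(ℝ, E) F x

theorem hasFDerivAt_differential {F : L → E} {x : L}
    (hF : MDifferentiableAt (𝓡 m) 𝓘(ℝ, E) F x) :
    HasFDerivAt (fun p => F ((extChartAt (𝓡 m) x).symm p)) (differential F x)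
      (extChartAt (𝓡 m) x x) := by
  have h1 : HasFDerivWithinAt (fun p => F ((extChartAt (𝓡 m) x).symm p)) (differential F x)
      (Set.range (𝓡 m)) (extChartAt (𝓡 m) x x) := hF.hasMFDerivAt.2
  rwa [ModelWithCorners.range_eq_univ, hasFDerivWithinAt_univ] at h1

theorem differential_smul {a : L → ℝ} {F : L → E} {x : L}
    (ha : MDifferentiableAt (𝓡 m) 𝓘(ℝ) a x) (hF : MDifferentiableAt (𝓡 m) 𝓘(ℝ, E) F x)
    (w : EuclideanSpace ℝ (Fin m)) :
    differential (fun y => a y • F y) x w =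
      a x • differential F x w + differential a x w • F x := by
  have h1 := (hasFDerivAt_differential (ha.smul hF)).unique
    ((hasFDerivAt_differential ha).smul (hasFDerivAt_differential hF))
  rw [show (fun y => a y • F y) = a • F from rfl, h1]
  simp

theorem differential_comp {f : ℝ → ℝ} {f' : ℝ} {a : L → ℝ} {x : L}
    (ha : MDifferentiableAt (𝓡 m) 𝓘(ℝ) a x) (hf : HasDerivAt f f' (a x))
    (w : EuclideanSpace ℝ (Fin m)) :
    differential (fun y => f (a y)) x w = f' * differential a x w := by
  have h0 : MDifferentiableAt (𝓡 m) 𝓘(ℝ) (fun y => f (a y)) x :=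
    hf.differentiableAt.mdifferentiableAt.comp x ha
  have hf' : HasDerivAt f f' (a ((extChartAt (𝓡 m) x).symm (extChartAt (𝓡 m) x x))) := by
    rwa [extChartAt_to_inv]
  have h1 := (hasFDerivAt_differential h0).unique
    (HasDerivAt.comp_hasFDerivAt (f := fun p => a ((extChartAt (𝓡 m) x).symm p)) _ hf'
      (hasFDerivAt_differential ha))
  rw [h1]
  simp

end Differential

/-! ### Conformal change of the Christoffel symbols. -/

section Christoffel

variable {n : ℕ} {M : Type*} [TopologicalSpace M]
  [ChartedSpace (EuclideanSpace ℝ (Fin n)) M] [IsManifold (𝓡 n) ∞ M]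

theorem euclidean_eq_sum_smul_single (v : EuclideanSpace ℝ (Fin n)) :
    v = ∑ i, v i • (EuclideanSpace.single i (1 : ℝ)) := by
  ext j
  simp [Pi.single_apply]

theorem inner_eq_sum_gram (h : Metric n M) (c : M) (v w : EuclideanSpace ℝ (Fin n)) :
    h.inner c v w = ∑ i, ∑ j, v i * w j * gram h c c i j := by
  let b : EuclideanSpace ℝ (Fin n) →L[ℝ] EuclideanSpace ℝ (Fin n) →L[ℝ] ℝ := h.inner c
  have hb (i j : Fin n) : gram h c c i j =
      b (EuclideanSpace.single i (1 : ℝ)) (EuclideanSpace.single j (1 : ℝ)) := by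
    unfold gram
    rw [coordVec_self, coordVec_self]
    rfl
  change b v w = _
  simp only [hb]
  conv_lhs => rw [euclidean_eq_sum_smul_single v, euclidean_eq_sum_smul_single w]
  simp only [map_sum, map_smul, sum_apply, smul_apply, smul_eq_mul,
    Finset.mul_sum, mul_assoc]
  rw [Finset.sum_comm]
  refine Finset.sum_congr rfl fun i _ => Finset.sum_congr rfl fun j _ => by ring

theorem gram_symm (h : Metric n M) (c x : M) (i j : Fin n) : gram h c x i j = gram h c x j i :=
  h.symm x _ _

/-- A nonzero kernel vector of the Gram matrix would have length zero, against positivity. -/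
theorem isUnit_det_gram (h : Metric n M) (c : M) : IsUnit (gram h c c).det := by
  rw [isUnit_iff_ne_zero]
  intro h0
  obtain ⟨v, hv, hgv⟩ := Matrix.exists_mulVec_eq_zero_iff.2 h0
  have hv' : (WithLp.toLp 2 v : EuclideanSpace ℝ (Fin n)) ≠ 0 := by
    intro h1
    exact hv (by simpa using h1)
  have hpos := h.pos c (WithLp.toLp 2 v : EuclideanSpace ℝ (Fin n)) hv'
  rw [inner_eq_sum_gram] at hpos
  have : ∑ i, v i * (gram h c c).mulVec v i = 0 := by simp [hgv]
  simp only [Matrix.mulVec, dotProduct, Finset.mul_sum] at this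
  refine hpos.ne' (Eq.trans ?_ this)
  exact Finset.sum_congr rfl fun i _ => Finset.sum_congr rfl fun j _ => by ring

theorem gram_inv_conformalMetric (h : Metric n M) (u : M → ℝ) (hu : ContMDiff (𝓡 n) 𝓘(ℝ) ∞ u)
    (c : M) : (gram (conformalMetric h u hu) c c)⁻¹ =
      Real.exp (-(2 * u c)) • (gram h c c)⁻¹ := by
  rw [gram_conformalMetric]
  have := Matrix.inv_smul' (gram h c c) (Units.mk0 _ (Real.exp_pos (2 * u c)).ne')
    (isUnit_det_gram h c)
  rw [Units.smul_mk0] at this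
  rw [this, Real.exp_neg]
  rfl

theorem differentiableAt_gram_extChartAt_symm (h : Metric n M) (c : M) (i j : Fin n) :
    DifferentiableAt ℝ (fun p => gram h c ((extChartAt (𝓡 n) c).symm p) i j)
      (extChartAt (𝓡 n) c c) := by
  have h1 := ((contMDiffOn_gram h c i j).comp (contMDiffOn_extChartAt_symm c)
    (extChartAt (𝓡 n) c).symm.mapsTo).contMDiffAt
    ((isOpen_extChartAt_target c).mem_nhds (mem_extChartAt_target c))
  exact h1.contDiffAt.differentiableAt (by simp)

theorem gramDeriv_conformalMetric (h : Metric n M) (u : M → ℝ) (hu : ContMDiff (𝓡 n) 𝓘(ℝ) ∞ u)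
    (c : M) (i j l : Fin n) :
    gramDeriv (conformalMetric h u hu) c i j l = Real.exp (2 * u c) * (gramDeriv h c i j l +
      2 * (differential u c (EuclideanSpace.single i (1 : ℝ)))
        * gram h c c j l) := by
  have h1 := ((hasFDerivAt_differential
    (hu.mdifferentiable (by simp) c)).const_mul 2).exp.mul
    (differentiableAt_gram_extChartAt_symm h c j l).hasFDerivAt
  unfold gramDeriv
  simp only [gram_conformalMetric, Matrix.smul_apply, smul_eq_mul]
  erw [h1.fderiv]
  simp
  ring

/-- The product rule for `e^{2u} h_{jl}` adds `2 ∂_i u h_{jl}` to each derivative inside the factor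
`e^{2u}`; that factor cancels the `e^{-2u}` of the inverse matrix. -/
theorem christoffel_conformalMetric (h : Metric n M) (u : M → ℝ)
    (hu : ContMDiff (𝓡 n) 𝓘(ℝ) ∞ u) (c : M) (k i j : Fin n) :
    christoffel (conformalMetric h u hu) c k i j = christoffel h c k i j +
      ∑ l, (gram h c c)⁻¹ k l *
        (differential u c (EuclideanSpace.single i (1 : ℝ))
            * gram h c c j l +
          differential u c (EuclideanSpace.single j (1 : ℝ))
            * gram h c c i l -
          differential u c (EuclideanSpace.single l (1 : ℝ))
            * gram h c c i j) := by
  have he : Real.exp (-(2 * u c)) * Real.exp (2 * u c) = 1 := by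
    rw [← Real.exp_add]; simp
  unfold christoffel
  rw [Finset.mul_sum, Finset.mul_sum, ← Finset.sum_add_distrib]
  refine Finset.sum_congr rfl fun l _ => ?_
  rw [gram_inv_conformalMetric]
  simp only [gramDeriv_conformalMetric, Matrix.smul_apply, smul_eq_mul]
  linear_combination (1 / 2 * (gram h c c)⁻¹ k l *
    (gramDeriv h c i j l + gramDeriv h c j i l - gramDeriv h c l i j +
      2 * (differential u c (EuclideanSpace.single i (1 : ℝ))
            * gram h c c j l +
          differential u c (EuclideanSpace.single j (1 : ℝ))
            * gram h c c i l -
          differential u c (EuclideanSpace.single l (1 : ℝ))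
            * gram h c c i j))) * he

theorem clm_eq_sum (L : EuclideanSpace ℝ (Fin n) →L[ℝ] ℝ) (v : EuclideanSpace ℝ (Fin n)) :
    L v = ∑ i, v i * L (EuclideanSpace.single i (1 : ℝ)) := by
  conv_lhs => rw [euclidean_eq_sum_smul_single v]
  simp

/-- Pairing with `z` lowers the upper index, which removes the inverse Gram matrix and turns the
difference of the connections into an expression without coordinates. -/
theorem inner_christoffelVec_conformalMetric (h : Metric n M) (u : M → ℝ)
    (hu : ContMDiff (𝓡 n) 𝓘(ℝ) ∞ u) (c : M) (v w z : EuclideanSpace ℝ (Fin n)) :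
    h.inner c (christoffelVec (conformalMetric h u hu) c v w : EuclideanSpace ℝ (Fin n)) z =
      h.inner c (christoffelVec h c v w : EuclideanSpace ℝ (Fin n)) z +
        differential u c v * h.inner c w z + differential u c w * h.inner c v z -
        differential u c z * h.inner c v w := by
  set e : Fin n → EuclideanSpace ℝ (Fin n) := fun l => EuclideanSpace.single l (1 : ℝ) with he
  set G := gram h c c with hG
  have hcoord (v : EuclideanSpace ℝ (Fin n)) (l : Fin n) :
      h.inner c v (e l) = ∑ j, v j * G j l := by
    rw [inner_eq_sum_gram]
    simp [e, G]
  -- `D` is the difference with its index lowered; `K` below is the vector obtained by raising it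
  -- again.
  let D : Fin n → ℝ := fun l => differential u c v * h.inner c w (e l) +
    differential u c w * h.inner c v (e l) - differential u c (e l) * h.inner c v w
  have hD (l : Fin n) : D l = ∑ i, ∑ j, (differential u c (e i) * G j l +
      differential u c (e j) * G i l - differential u c (e l) * G i j) * v i * w j := by
    simp only [D]
    rw [hcoord, hcoord, clm_eq_sum (differential u c) v, clm_eq_sum (differential u c) w,
      inner_eq_sum_gram, Finset.sum_mul_sum, Finset.sum_mul_sum, Finset.mul_sum, Finset.sum_comm
      (f := fun i j => w i * differential u c (EuclideanSpace.single i (1 : ℝ)) * (v j * G j l)),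
      ← Finset.sum_add_distrib, ← Finset.sum_sub_distrib]
    refine Finset.sum_congr rfl fun i _ => ?_
    rw [Finset.mul_sum, ← Finset.sum_add_distrib, ← Finset.sum_sub_distrib]
    refine Finset.sum_congr rfl fun j _ => ?_
    simp only [e, G]
    ring
  let K : EuclideanSpace ℝ (Fin n) := WithLp.toLp 2 ((G⁻¹).mulVec D)
  have hK : christoffelVec (conformalMetric h u hu) c v w = christoffelVec h c v w + K := by
    ext k
    have hk : ∑ l, G⁻¹ k l * D l = ∑ i, ∑ j, (∑ l, G⁻¹ k l * (differential u c (e i) * G j l +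
        differential u c (e j) * G i l - differential u c (e l) * G i j)) * v i * w j := by
      simp only [hD, Finset.mul_sum, Finset.sum_mul]
      rw [Finset.sum_comm]
      refine Finset.sum_congr rfl fun i _ => ?_
      rw [Finset.sum_comm]
      exact Finset.sum_congr rfl fun j _ => Finset.sum_congr rfl fun l _ => by ring
    simp only [christoffelVec, christoffel_conformalMetric, PiLp.add_apply, K, Matrix.mulVec,
      dotProduct, hk, add_mul, Finset.sum_add_distrib]
    rfl
  have hKz : h.inner c (K : EuclideanSpace ℝ (Fin n)) z = ∑ l, z l * D l := by
    have h1 : G.mulVec ((G⁻¹).mulVec D) = D := by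
      rw [Matrix.mulVec_mulVec, Matrix.mul_nonsing_inv _ (isUnit_det_gram h c), Matrix.one_mulVec]
    rw [inner_eq_sum_gram, Finset.sum_comm]
    refine Finset.sum_congr rfl fun l _ => ?_
    conv_rhs => rw [← h1, Matrix.mulVec, dotProduct, Finset.mul_sum]
    refine Finset.sum_congr rfl fun k _ => ?_
    simp only [K, hG, gram_symm h c c k l]
    ring
  have hlin (v z : EuclideanSpace ℝ (Fin n)) : h.inner c v z = ∑ l, z l * h.inner c v (e l) :=
    clm_eq_sum (h.inner c v) z
  have hsum : ∑ l, z l * D l = differential u c v * h.inner c w z +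
      differential u c w * h.inner c v z - differential u c z * h.inner c v w := by
    rw [hlin w z, hlin v z, clm_eq_sum (differential u c) z, Finset.mul_sum, Finset.mul_sum,
      Finset.sum_mul, ← Finset.sum_add_distrib, ← Finset.sum_sub_distrib]
    refine Finset.sum_congr rfl fun l _ => ?_
    simp only [D, e]
    ring
  have hadd : h.inner c (christoffelVec h c v w + K : EuclideanSpace ℝ (Fin n)) z =
      h.inner c (christoffelVec h c v w : EuclideanSpace ℝ (Fin n)) z + h.inner c K z :=
    congrArg (fun A => A z) (map_add (h.inner c) _ _)
  rw [hK, hadd, hKz, hsum]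
  ring

end Christoffel

/-! ### Linearity and the Leibniz rule for the covariant derivative along a map. -/

section CovDeriv

variable {n : ℕ} {M : Type*} [TopologicalSpace M]
  [ChartedSpace (EuclideanSpace ℝ (Fin n)) M] [IsManifold (𝓡 n) ∞ M]
  {m : ℕ} {L : Type*} [TopologicalSpace L] [ChartedSpace (EuclideanSpace ℝ (Fin m)) L]

theorem christoffelVec_smul_left (h : Metric n M) (c : M) (r : ℝ)
    (v w : EuclideanSpace ℝ (Fin n)) :
    christoffelVec h c (r • v) w = r • christoffelVec h c v w := by
  ext k
  simp only [christoffelVec, PiLp.smul_apply, smul_eq_mul, Finset.mul_sum]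
  exact Finset.sum_congr rfl fun i _ => Finset.sum_congr rfl fun j _ => by ring

theorem christoffelVec_smul_right (h : Metric n M) (c : M) (r : ℝ)
    (v w : EuclideanSpace ℝ (Fin n)) :
    christoffelVec h c v (r • w) = r • christoffelVec h c v w := by
  ext k
  simp only [christoffelVec, PiLp.smul_apply, smul_eq_mul, Finset.mul_sum]
  exact Finset.sum_congr rfl fun i _ => Finset.sum_congr rfl fun j _ => by ring

theorem covDerivAlong_smul_right (g : Metric n M) (f : L → M)
    (X : (y : L) → TangentSpace (𝓡 n) (f y)) (x : L) (r : ℝ) (w : TangentSpace (𝓡 m) x) :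
    covDerivAlong g f X x (r • w) = r • covDerivAlong g f X x w := by
  unfold covDerivAlong
  simp only [map_smul]
  erw [christoffelVec_smul_left]
  exact (smul_add r _ _).symm

theorem covDerivAlong_smul_left (g : Metric n M) (f : L → M)
    (X : (y : L) → TangentSpace (𝓡 n) (f y)) (x : L) (w : TangentSpace (𝓡 m) x) {a : L → ℝ}
    (ha : MDifferentiableAt (𝓡 m) 𝓘(ℝ) a x)
    (hX : MDifferentiableAt (𝓡 m) (𝓡 n).tangent
      (fun y => (⟨f y, X y⟩ : TangentBundle (𝓡 n) M)) x) :
    covDerivAlong g f (fun y => a y • X y) x w =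
      a x • covDerivAlong g f X x w + differential a x w • X x := by
  set t := trivializationAt (EuclideanSpace ℝ (Fin n)) (fun z : M => TangentSpace (𝓡 n) z) (f x)
    with ht
  obtain ⟨hf, hX'⟩ := (mdifferentiableAt_totalSpace (IB := 𝓡 n) _).1 hX
  have hY : MDifferentiableAt (𝓡 m) 𝓘(ℝ, EuclideanSpace ℝ (Fin n))
      (fun y => (t ⟨f y, X y⟩).2) x := hX'
  have hev : (fun y => (t ⟨f y, a y • X y⟩).2) =ᶠ[𝓝 x] fun y => a y • (t ⟨f y, X y⟩).2 := by
    have hbase : ∀ᶠ y in 𝓝 x, f y ∈ t.baseSet :=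
      hf.continuousAt.eventually
        (t.open_baseSet.mem_nhds (FiberBundle.mem_baseSet_trivializationAt' (f x)))
    filter_upwards [hbase] with y hy
    exact (t.linear ℝ hy).map_smul (a y) (X y)
  -- The same vectors, viewed in the model spaces, where differentials and Christoffel vectors can
  -- be added; the goal then agrees with `h2` by definition.
  let w₀ : EuclideanSpace ℝ (Fin m) := w
  let v : EuclideanSpace ℝ (Fin n) := mfderiv (𝓡 m) (𝓡 n) f x w
  let X₀ : EuclideanSpace ℝ (Fin n) := X x
  have hX₀ : (t ⟨f x, X x⟩).2 = X₀ := trivialization_self (f x) (X x)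
  have h1 : differential (m := m) (fun y => (t ⟨f y, a y • X y⟩).2) x =
      differential (fun y => a y • (t ⟨f y, X y⟩).2) x := hev.mfderiv_eq
  have h2 : differential (fun y => (t ⟨f y, a y • X y⟩).2) x w₀ +
      christoffelVec g (f x) v (a x • X₀) =
      a x • (differential (fun y => (t ⟨f y, X y⟩).2) x w₀ + christoffelVec g (f x) v X₀) +
        differential a x w₀ • X₀ := by
    rw [h1, differential_smul ha hY, hX₀, christoffelVec_smul_right]
    module
  exact h2

end CovDeriv

/-! ### Clifford algebra in dimension two. -/

section Algebra

variable {V : Type*} [AddCommGroup V] [Module ℝ V]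

theorem matAct_smul (A : Matrix (Fin 2) (Fin 2) ℂ) (r : ℝ) (ψ : Fin 2 → V × V) :
    matAct A (r • ψ) = r • matAct A ψ := by
  funext a
  simp only [matAct, cxSmul, Pi.smul_apply, Finset.smul_sum]
  refine Finset.sum_congr rfl fun b _ => ?_
  ext <;> simp [smul_add, smul_sub, smul_comm r]

/-- The terms of the Dirac operator that come from differentiating the conformal factor cancel
those that come from the change of the spin connection. -/
theorem clifford_conformal_cancel (T₀ T₁ P : Fin 2 → V × V) (r a b : ℝ) :
    matAct (gamma 0) (r • (T₀ - (a / 2) • P - (b / 2) • matAct (gamma 0 * gamma 1) P)) +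
      matAct (gamma 1) (r • (T₁ - (b / 2) • P + (a / 2) • matAct (gamma 0 * gamma 1) P)) =
    r • (matAct (gamma 0) T₀ + matAct (gamma 1) T₁) := by
  -- Behind the computation lie `γ_0 γ_0 γ_1 = -γ_1` and `γ_1 γ_0 γ_1 = γ_0`: the `a` terms cancel
  -- as multiples of `γ_0 P`, the `b` terms as multiples of `γ_1 P`.
  funext i
  fin_cases i <;> ext <;>
    simp [matAct, cxSmul, gamma, Fin.sum_univ_two] <;> module

theorem hermitian_smul_smul (g : V → V → ℝ) (a b : ℝ)
    (hg : ∀ v w, g (a • v) (b • w) = a * b * g v w) (χ ξ : Fin 2 → V × V) :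
    hermitian g (a • χ) (b • ξ) = ((a * b : ℝ) : ℂ) * hermitian g χ ξ := by
  simp only [hermitian, Pi.smul_apply, Prod.smul_fst, Prod.smul_snd, hg, Finset.mul_sum]
  refine Finset.sum_congr rfl fun i _ => ?_
  push_cast
  ring

end Algebra

/-! ### Conformal change of the connection, the Dirac operator and the densities. -/

section Conformal

variable {M : Type*} [TopologicalSpace M]
  [ChartedSpace (EuclideanSpace ℝ (Fin 2)) M] [IsManifold (𝓡 2) ∞ M]

theorem SpinStructure.mem_idx {h : Metric 2 M} (s : SpinStructure h) (x : M) : x ∈ s.U (s.idx x) :=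
  (s.cover x).choose_spec

theorem inner_covDerivAlong_id_conformalMetric (h : Metric 2 M) {u : M → ℝ}
    (hu : ContMDiff (𝓡 2) 𝓘(ℝ) ∞ u) (X : (y : M) → TangentSpace (𝓡 2) y) (x : M)
    (w z : TangentSpace (𝓡 2) x) :
    h.inner x (covDerivAlong (conformalMetric h u hu) (id : M → M) X x w) z =
      h.inner x (covDerivAlong h (id : M → M) X x w) z + differential u x w * h.inner x (X x) z +
        differential u x (X x) * h.inner x w z - differential u x z * h.inner x w (X x) := by
  have hid : mfderiv (𝓡 2) (𝓡 2) (id : M → M) x w = w := by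
    rw [mfderiv_id]
    rfl
  unfold covDerivAlong
  rw [hid]
  -- The coordinate derivative `d` of the field is independent of the metric, so only the
  -- Christoffel terms differ.
  have key (d Γ Γ' : EuclideanSpace ℝ (Fin 2)) (p q r : ℝ)
      (hΓ : h.inner x Γ' z = h.inner x Γ z + p + q - r) :
      h.inner x (d + Γ' : EuclideanSpace ℝ (Fin 2)) z =
        h.inner x (d + Γ : EuclideanSpace ℝ (Fin 2)) z + p + q - r := by
    have hadd (Γ : EuclideanSpace ℝ (Fin 2)) : h.inner x (d + Γ : EuclideanSpace ℝ (Fin 2)) z =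
        h.inner x d z + h.inner x Γ z := congrArg (fun A => A z) (map_add (h.inner x) d Γ)
    rw [hadd, hadd, hΓ]
    ring
  exact key _ _ _ _ _ _ (inner_christoffelVec_conformalMetric h u hu x w (X x) z)

/-- The factors `e^{2u}`, `e^{-u}`, `e^{-u}` multiply to one. Both the derivative of `e^{-u}` and
the term with `du(w)` give multiples of the first frame vector, which is orthogonal to the second.
-/
theorem connectionForm_conformal {h : Metric 2 M} (s : SpinStructure h) {u : M → ℝ}
    (hu : ContMDiff (𝓡 2) 𝓘(ℝ) ∞ u) (i : s.ι) {x : M} (hx : x ∈ s.U i)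
    (w : TangentSpace (𝓡 2) x) :
    connectionForm (s.conformal u hu) i x w = connectionForm s i x w +
      differential u x (s.e i 0 x) * h.inner x w (s.e i 1 x) -
      differential u x (s.e i 1 x) * h.inner x w (s.e i 0 x) := by
  have hX : MDifferentiableAt (𝓡 2) (𝓡 2).tangent
      (fun y => (⟨id y, s.e i 0 y⟩ : TangentBundle (𝓡 2) M)) x :=
    ((s.e_smooth i 0).contMDiffAt ((s.isOpen i).mem_nhds hx)).mdifferentiableAt (by simp)
  have ha : MDifferentiableAt (𝓡 2) 𝓘(ℝ) (fun y => Real.exp (-u y)) x :=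
    (Real.contDiff_exp.contMDiff.comp hu.neg).mdifferentiable (n := ∞) (by simp) x
  have h01 : h.inner x (s.e i 0 x) (s.e i 1 x) = 0 := by simpa using s.orthonormal i x hx 0 1
  have he : Real.exp (2 * u x) * (Real.exp (-u x) * Real.exp (-u x)) = 1 := by
    rw [← Real.exp_add, ← Real.exp_add]; ring_nf; simp
  have h1 : connectionForm (s.conformal u hu) i x w = Real.exp (2 * u x) *
      h.inner x (covDerivAlong (conformalMetric h u hu) (id : M → M)
        (fun y => Real.exp (-u y) • s.e i 0 y) x w) (Real.exp (-u x) • s.e i 1 x) := rfl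
  have h2 := covDerivAlong_smul_left (conformalMetric h u hu) (id : M → M) (s.e i 0) x w ha hX
  have h3 : h.inner x (covDerivAlong (conformalMetric h u hu) (id : M → M)
        (fun y => Real.exp (-u y) • s.e i 0 y) x w) (s.e i 1 x) =
      Real.exp (-u x) * h.inner x (covDerivAlong (conformalMetric h u hu) (id : M → M)
        (s.e i 0) x w) (s.e i 1 x) := by
    have hlin (A D : TangentSpace (𝓡 2) x) (r t : ℝ) (hD : h.inner x D (s.e i 1 x) = 0) :
        h.inner x (r • A + t • D) (s.e i 1 x) = r * h.inner x A (s.e i 1 x) := by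
      simp [hD]
    exact (congrArg (fun A => h.inner x A (s.e i 1 x)) h2).trans (hlin _ _ _ _ h01)
  rw [h1, map_smul, smul_eq_mul, h3, inner_covDerivAlong_id_conformalMetric, h01]
  unfold connectionForm
  linear_combination (h.inner x (covDerivAlong h (id : M → M) (s.e i 0) x w) (s.e i 1 x) +
    differential u x (s.e i 0 x) * h.inner x w (s.e i 1 x) -
      differential u x (s.e i 1 x) * h.inner x w (s.e i 0 x)) * he

variable {n : ℕ} {N : Type*} [TopologicalSpace N]
  [ChartedSpace (EuclideanSpace ℝ (Fin n)) N] [IsManifold (𝓡 n) ∞ N]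

theorem twistedDeriv_smul {h : Metric 2 M} {s : SpinStructure h} {φ : M → N} (g : Metric n N)
    (ψ : VectorSpinor n s φ) (i : s.ι) (x : M) (r : ℝ) (w : TangentSpace (𝓡 2) x) :
    twistedDeriv g ψ i x (r • w) = r • twistedDeriv g ψ i x w := by
  have h1 : connectionForm s i x (r • w) = r * connectionForm s i x w := by
    unfold connectionForm
    rw [covDerivAlong_smul_right]
    exact congrArg (fun A => A (s.e i 1 x)) (map_smul (h.inner x) r _)
  unfold twistedDeriv
  rw [h1, smul_add, smul_smul, mul_left_comm]
  congr 1
  funext a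
  exact Prod.ext (covDerivAlong_smul_right _ _ _ _ _ _) (covDerivAlong_smul_right _ _ _ _ _ _)

/-- The weight `-1/2` of the spinor produces the term in `du(w)`; the last term is half the change
of the connection form. The target metric is fixed, so the connection along `φ` contributes nothing
else. -/
theorem twistedDeriv_conformal {h : Metric 2 M} {s : SpinStructure h} {φ : M → N} (g : Metric n N)
    (ψ : VectorSpinor n s φ) {u : M → ℝ} (hu : ContMDiff (𝓡 2) 𝓘(ℝ) ∞ u) (i : s.ι) {x : M}
    (hx : x ∈ s.U i) (w : TangentSpace (𝓡 2) x) :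
    twistedDeriv g (ψ.conformal u hu) i x w = Real.exp (-u x / 2) • (twistedDeriv g ψ i x w -
      (differential u x w / 2) • ψ.comp i x +
      ((differential u x (s.e i 0 x) * h.inner x w (s.e i 1 x) -
        differential u x (s.e i 1 x) * h.inner x w (s.e i 0 x)) / 2) •
        matAct (gamma 0 * gamma 1) (ψ.comp i x)) := by
  have hu' := hu.mdifferentiable (by simp) x
  have ha : MDifferentiableAt (𝓡 2) 𝓘(ℝ) (fun y => Real.exp (-u y / 2)) x :=
    (Real.contDiff_exp.contMDiff.comp (hu.neg.div_const 2)).mdifferentiable (n := ∞) (by simp) x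
  have hda : differential (fun y => Real.exp (-u y / 2)) x w =
      -(1 / 2) * Real.exp (-u x / 2) * differential u x w := by
    refine differential_comp (f := fun t => Real.exp (-t / 2)) hu' ?_ w
    exact ((hasDerivAt_id (u x)).fun_neg.div_const 2).exp.congr_deriv (by simp only [id]; ring)
  have hX {X : (y : M) → TangentSpace (𝓡 n) (φ y)} (hX : ContMDiffOn (𝓡 2) (𝓡 n).tangent ∞
      (fun y => (⟨φ y, X y⟩ : TangentBundle (𝓡 n) N)) (s.U i)) :
      covDerivAlong g φ (fun y => Real.exp (-u y / 2) • X y) x w = Real.exp (-u x / 2) •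
        (covDerivAlong g φ X x w - (differential u x w / 2) • X x) := by
    have h1 := covDerivAlong_smul_left g φ X x w ha
      ((hX.contMDiffAt ((s.isOpen i).mem_nhds hx)).mdifferentiableAt (by simp))
    rw [h1, hda]
    module
  have h1 : twistedDeriv g (ψ.conformal u hu) i x w =
    (fun a => (covDerivAlong g φ (fun y => Real.exp (-u y / 2) • (ψ.comp i y a).1) x w,
        covDerivAlong g φ (fun y => Real.exp (-u y / 2) • (ψ.comp i y a).2) x w)) +
      ((1 / 2) * connectionForm (s.conformal u hu) i x w) •
        matAct (gamma 0 * gamma 1) (Real.exp (-u x / 2) • ψ.comp i x) := rfl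
  have h2 : (fun a => (covDerivAlong g φ (fun y => Real.exp (-u y / 2) • (ψ.comp i y a).1) x w,
        covDerivAlong g φ (fun y => Real.exp (-u y / 2) • (ψ.comp i y a).2) x w)) =
      Real.exp (-u x / 2) • ((fun a => (covDerivAlong g φ (fun y => (ψ.comp i y a).1) x w,
        covDerivAlong g φ (fun y => (ψ.comp i y a).2) x w)) -
        (differential u x w / 2) • ψ.comp i x) := by
    funext a
    exact Prod.ext (hX (ψ.smooth_re i a)) (hX (ψ.smooth_im i a))
  rw [h1, h2, connectionForm_conformal s hu i hx, matAct_smul]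
  unfold twistedDeriv
  module

/-- The direction of differentiation contributes `e^{-u}` and the spinor `e^{-u/2}`. At `w = e_a`,
orthonormality leaves one derivative of `u` in each connection correction, the pattern that
`clifford_conformal_cancel` removes. -/
theorem dirac_conformal {h : Metric 2 M} {s : SpinStructure h} {φ : M → N} (g : Metric n N)
    (ψ : VectorSpinor n s φ) {u : M → ℝ} (hu : ContMDiff (𝓡 2) 𝓘(ℝ) ∞ u) (i : s.ι) {x : M}
    (hx : x ∈ s.U i) :
    dirac g (ψ.conformal u hu) i x =
      (Real.exp (-u x) * Real.exp (-u x / 2)) • dirac g ψ i x := by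
  have he (a : Fin 2) : (s.conformal u hu).e i a x = Real.exp (-u x) • s.e i a x := rfl
  have hT (w : TangentSpace (𝓡 2) x) :
      twistedDeriv g (ψ.conformal u hu) i x (Real.exp (-u x) • w) =
        Real.exp (-u x) • twistedDeriv g (ψ.conformal u hu) i x w :=
    twistedDeriv_smul g (ψ.conformal u hu) i x _ w
  have h00 : h.inner x (s.e i 0 x) (s.e i 0 x) = 1 := by simpa using s.orthonormal i x hx 0 0
  have h01 : h.inner x (s.e i 0 x) (s.e i 1 x) = 0 := by simpa using s.orthonormal i x hx 0 1
  have h10 : h.inner x (s.e i 1 x) (s.e i 0 x) = 0 := by simpa using s.orthonormal i x hx 1 0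
  have h11 : h.inner x (s.e i 1 x) (s.e i 1 x) = 1 := by simpa using s.orthonormal i x hx 1 1
  unfold dirac
  rw [Fin.sum_univ_two, Fin.sum_univ_two, he, he, hT, hT,
    twistedDeriv_conformal g ψ hu i hx, twistedDeriv_conformal g ψ hu i hx,
    h00, h01, h10, h11, ← clifford_conformal_cancel _ _ (ψ.comp i x) _
      (differential u x (s.e i 0 x)) (differential u x (s.e i 1 x))]
  simp only [smul_smul, mul_zero, mul_one, zero_sub, sub_zero, neg_div, neg_smul,
    ← sub_eq_add_neg]

theorem dirichletDensity_conformal (h : Metric 2 M) (g : Metric n N) (φ : M → N) {u : M → ℝ}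
    (hu : ContMDiff (𝓡 2) 𝓘(ℝ) ∞ u) (x : M) :
    dirichletDensity h g φ x =
      Real.exp (2 * u x) * dirichletDensity (conformalMetric h u hu) g φ x := by
  have he : Real.exp (2 * u x) * Real.exp (-(2 * u x)) = 1 := by
    rw [← Real.exp_add]; simp
  simp only [dirichletDensity, gram_inv_conformalMetric, Finset.mul_sum, Matrix.smul_apply,
    smul_eq_mul, ← mul_assoc, he, one_mul]

theorem diracDensity_conformal {h : Metric 2 M} {s : SpinStructure h} {φ : M → N}
    (g : Metric n N) (ψ : VectorSpinor n s φ) {u : M → ℝ} (hu : ContMDiff (𝓡 2) 𝓘(ℝ) ∞ u)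
    (x : M) :
    diracDensity g ψ x = (Real.exp (2 * u x) : ℂ) * diracDensity g (ψ.conformal u hu) x := by
  have he : Real.exp (2 * u x) *
      (Real.exp (-u x / 2) * (Real.exp (-u x) * Real.exp (-u x / 2))) = 1 := by
    rw [← Real.exp_add, ← Real.exp_add, ← Real.exp_add]; ring_nf; simp
  -- Both spin structures have the same cover, so they choose the same index at `x`.
  have h1 : diracDensity g (ψ.conformal u hu) x =
      hermitian (fun v w => g.inner (φ x) v w) (Real.exp (-u x / 2) • ψ.comp (s.idx x) x)
        (dirac g (ψ.conformal u hu) (s.idx x) x) := rfl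
  rw [h1, dirac_conformal g ψ hu _ (s.mem_idx x), hermitian_smul_smul, ← mul_assoc,
    ← Complex.ofReal_mul, he, Complex.ofReal_one, one_mul]
  · rfl
  · intro v w
    simp [mul_assoc, mul_left_comm]

theorem magneticDensity_conformal {h : Metric 2 M} (s : SpinStructure h) (B : TwoForm n N)
    (φ : M → N) {u : M → ℝ} (hu : ContMDiff (𝓡 2) 𝓘(ℝ) ∞ u) (x : M) :
    magneticDensity s B φ x =
      Real.exp (2 * u x) * magneticDensity (s.conformal u hu) B φ x := by
  have he : Real.exp (2 * u x) * (Real.exp (-u x) * Real.exp (-u x)) = 1 := by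
    rw [← Real.exp_add, ← Real.exp_add]; ring_nf; simp
  have h1 : magneticDensity (s.conformal u hu) B φ x =
    B.form (φ x) (mfderiv (𝓡 2) (𝓡 n) φ x (Real.exp (-u x) • s.e (s.idx x) 0 x))
      (mfderiv (𝓡 2) (𝓡 n) φ x (Real.exp (-u x) • s.e (s.idx x) 1 x)) := rfl
  rw [h1]
  simp only [map_smul, smul_apply, smul_eq_mul]
  unfold magneticDensity
  linear_combination (-B.form (φ x) (mfderiv (𝓡 2) (𝓡 n) φ x (s.e (s.idx x) 0 x))
    (mfderiv (𝓡 2) (𝓡 n) φ x (s.e (s.idx x) 1 x))) * he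

end Conformal

end MagneticDirac

end

theorem mainTheorem10
    {M : Type*} [TopologicalSpace M] [ChartedSpace (EuclideanSpace ℝ (Fin 2)) M]
    [IsManifold (𝓡 2) ∞ M] [T2Space M] [CompactSpace M] [MeasurableSpace M] [BorelSpace M]
    {n : ℕ} {N : Type*} [TopologicalSpace N] [ChartedSpace (EuclideanSpace ℝ (Fin n)) N]
    [IsManifold (𝓡 n) ∞ N] [T2Space N] [SecondCountableTopology N]
    (h : MagneticDirac.Metric 2 M) (s : MagneticDirac.SpinStructure h)
    (g : MagneticDirac.Metric n N) (B : MagneticDirac.TwoForm n N)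
    (φ : M → N) (hφ : ContMDiff (𝓡 2) (𝓡 n) ∞ φ) (ψ : MagneticDirac.VectorSpinor n s φ)
    (u : M → ℝ) (hu : ContMDiff (𝓡 2) 𝓘(ℝ) ∞ u) :
    MagneticDirac.dirichletTerm (MagneticDirac.conformalMetric h u hu) g φ =
        MagneticDirac.dirichletTerm h g φ ∧
      MagneticDirac.diracTerm g (ψ.conformal u hu) = MagneticDirac.diracTerm g ψ ∧
      MagneticDirac.magneticTerm (s.conformal u hu) B φ = MagneticDirac.magneticTerm s B φ ∧
      MagneticDirac.energy g B (ψ.conformal u hu) = MagneticDirac.energy g B ψ := by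
  refine ⟨?_, ?_, ?_, ?_⟩
  · exact MagneticDirac.integral_volumeMeasure_conformalMetric h u hu
      (MagneticDirac.dirichletDensity_conformal h g φ hu)
  · refine MagneticDirac.integral_volumeMeasure_conformalMetric h u hu fun x => ?_
    rw [Complex.real_smul]
    exact MagneticDirac.diracDensity_conformal g ψ hu x
  · exact MagneticDirac.integral_volumeMeasure_conformalMetric h u hu
      (MagneticDirac.magneticDensity_conformal s B φ hu)
  -- The whole integrand is compared pointwise: splitting the integral of the sum would require
  -- integrability.
  · refine congrArg (fun z : ℂ => 1 / 2 * z)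
      (MagneticDirac.integral_volumeMeasure_conformalMetric h u hu fun x => ?_)
    rw [MagneticDirac.dirichletDensity_conformal h g φ hu,
      MagneticDirac.diracDensity_conformal g ψ hu, MagneticDirac.magneticDensity_conformal s B φ hu,
      Complex.real_smul]
    push_cast
    ring
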